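/- Let $G$ be a group. Call a subgroup $H\le G$ \emph{extreme} if $H$ has finite index in $G$ or $H$ is not contained in any proper subgroup of finite index of $G$. A \emph{complement} of a subgroup $H\le G$ is a proper subgroup $K<G$ with $G=HK$ (it is not required that $H\cap K=1$), and a \emph{common complement} of a finite collection $H_1,\dots,H_n\le G$ is a complement of the intersection $H_1\cap\cdots\cap H_n$, where the intersection of the empty collection ($n=0$) is $G$. The \emph{coset nerve} of all proper subgroups of $G$ is the simplicial complex whose vertices are all subsets $gH\subseteq G$ with $g\in G$ and $H<G$ a proper subgroup, and in which a nonempty finite set of vertices is a simplex if and only if the corresponding cosets have a common element. Proposition. If every finite (possibly empty) collection $H_1,\dots,H_n$ of proper extreme subgroups of $G$ has a common complement in $G$, then the geometric realization (with the weak topology) of the coset nerve of all proper subgroups of $G$ is contractible. -/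

import Mathlib

open scoped Pointwise

namespace CosetNerve

section Realization

variable {V : Type*} (K : PreAbstractSimplicialComplex V)

/-- The underlying set of the geometric realization of an abstract simplicial complex, in
barycentric coordinates: finitely supported functions on the vertices with nonnegative values and
sum one, whose support is a simplex. -/
def Realization : Type _ :=
  {x : V →₀ ℝ // (∀ v, 0 ≤ x v) ∧ (x.sum fun _ a => a) = 1 ∧ x.support ∈ K.faces}

open Classical in
/-- Extension by zero of barycentric coordinates on a finite set `σ` of vertices. -/
noncomputable def extendByZero (σ : Finset V) (w : σ → ℝ) : V →₀ ℝ :=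
  Finsupp.onFinset σ (fun v => if h : v ∈ σ then w ⟨v, h⟩ else 0) (by
    intro v hv
    by_contra h
    simp [h] at hv)

theorem extendByZero_nonneg (σ : Finset V) (w : σ → ℝ) (hw : w ∈ stdSimplex ℝ σ) (v : V) :
    0 ≤ extendByZero σ w v := by
  classical
  by_cases h : v ∈ σ
  · simpa [extendByZero, h] using hw.1 ⟨v, h⟩
  · simp [extendByZero, h]

theorem extendByZero_sum (σ : Finset V) (w : σ → ℝ) (hw : w ∈ stdSimplex ℝ σ) :
    ((extendByZero σ w).sum fun _ a => a) = 1 := by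
  classical
  rw [extendByZero, Finsupp.onFinset_sum _ (fun _ => rfl), ← hw.2, ← Finset.sum_coe_sort σ]
  exact Finset.sum_congr rfl fun v _ => by simp

theorem extendByZero_support (σ : Finset V) (hσ : σ ∈ K.faces) (w : σ → ℝ)
    (hw : w ∈ stdSimplex ℝ σ) : (extendByZero σ w).support ∈ K.faces := by
  refine (K.isRelLowerSet_faces hσ).2 Finsupp.support_onFinset_subset ?_
  rw [Finset.nonempty_iff_ne_empty]
  intro h
  have h1 := extendByZero_sum σ w hw
  rw [Finsupp.sum, h, Finset.sum_empty] at h1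
  exact zero_ne_one h1

/-- The characteristic map of a simplex `σ`: the standard simplex on the vertices of `σ`
(with its Euclidean topology), mapped into the realization by extending coordinates by zero. -/
noncomputable def simplexMap (σ : K.faces) (w : stdSimplex ℝ σ.1) : Realization K :=
  ⟨extendByZero σ.1 w.1, extendByZero_nonneg σ.1 w.1 w.2, extendByZero_sum σ.1 w.1 w.2,
    extendByZero_support K σ.1 σ.2 w.1 w.2⟩

/-- The weak (coherent) topology on the geometric realization: a set is closed if and only if
its preimage in each closed simplex is closed. -/
noncomputable instance : TopologicalSpace (Realization K) :=
  ⨆ σ : K.faces, TopologicalSpace.coinduced (simplexMap K σ) inferInstance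

end Realization

/-- The nerve of a (self-indexing) family `𝓕` of subsets of a set: the vertices are the members
of `𝓕`, and a nonempty finite set of members is a simplex if its members have a common point. -/
def nerve {X : Type*} (𝓕 : Set (Set X)) : PreAbstractSimplicialComplex 𝓕 where
  faces := {σ | σ.Nonempty ∧ (⋂ A ∈ σ, (A : Set X)).Nonempty}
  isRelLowerSet_faces := fun _ hσ =>
    ⟨hσ.1, fun _ hτσ hτ => ⟨hτ, hσ.2.mono (Set.biInter_subset_biInter_left hτσ)⟩⟩

variable {G : Type*} [Group G]

/-- The collection of all (left) cosets of the members of a set of subgroups. -/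
def cosets (𝓗 : Set (Subgroup G)) : Set (Set G) :=
  {A | ∃ H ∈ 𝓗, ∃ g : G, A = g • (H : Set G)}

/-- The coset nerve of a set of subgroups. -/
def cosetNerve (𝓗 : Set (Subgroup G)) : PreAbstractSimplicialComplex (cosets 𝓗) :=
  nerve (cosets 𝓗)

variable (G) in
/-- The family of all proper subgroups of `G`. -/
def properSubgroups : Set (Subgroup G) := {H | H ≠ ⊤}

/-- A subgroup is extreme if it has finite index or is not contained in any proper subgroup of
finite index. -/
def IsExtreme (H : Subgroup G) : Prop :=
  H.FiniteIndex ∨ ¬ ∃ L : Subgroup G, L ≠ ⊤ ∧ L.FiniteIndex ∧ H ≤ L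

/-- `K` is a complement of `H`: a proper subgroup with `G = H K` (trivial intersection of `H` and
`K` is not required). -/
def IsComplementOf (K H : Subgroup G) : Prop :=
  K ≠ ⊤ ∧ (H : Set G) * (K : Set G) = Set.univ

/-- `K` is a common complement of a finite collection of subgroups: a complement of their
intersection (which is `G` for the empty collection). -/
def IsCommonComplementOf (K : Subgroup G) (𝓢 : Finset (Subgroup G)) : Prop :=
  IsComplementOf K (⨅ H ∈ 𝓢, H)

end CosetNerve

namespace CosetNerve

/-! ### Continuity and homotopies for the weak topology -/

section Topology

variable {V : Type*} {K : PreAbstractSimplicialComplex V}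

/-! Every proper subgroup lies in a proper extreme one, so each coset `A` can be enlarged to an
extreme coset `r A`. Enlarging keeps common points, so `r` is contiguous to the identity. Given
finitely many extreme cosets of subgroups `Hᵢ`, take a common complement `K` and enlarge it to a
proper extreme `L`. If `x` lies in some of the cosets, write `x⁻¹ = ab` with `a ∈ ⋂ Hᵢ`, `b ∈ K`.
Then `xa` stays in those cosets and equals `b⁻¹ ∈ L`, so `L` is a cone apex (`exists_cone_vertex`).

`contractibleSpace_of_cones` turns this into an explicit contraction. Apexes are chosen recursively
for all finite vertex sets `S`: the apex of `S` cones off `r S` and the apexes of the proper subsets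
of `S`. Chains of sets then yield simplices (`chainVertex_simplex`), so the subdivision of the full
simplex on all vertices maps to the complex. The restriction of this map to the complex is homotopic
to the map induced by `r`, hence to the identity. It is also nullhomotopic, because the full simplex
contracts to a vertex. -/

theorem Realization.support_nonempty (x : Realization K) : x.1.support.Nonempty :=
  (K.isRelLowerSet_faces x.2.2.2).1

theorem continuous_simplexMap (σ : K.faces) : Continuous (simplexMap K σ) :=
  continuous_iff_coinduced_le.2 (le_iSup (fun σ : K.faces =>
    TopologicalSpace.coinduced (simplexMap K σ) inferInstance) σ)

theorem continuous_realization_iff {Y : Type*} [TopologicalSpace Y] {f : Realization K → Y} :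
    Continuous f ↔ ∀ σ : K.faces, Continuous (f ∘ simplexMap K σ) := by
  rw [continuous_iSup_dom]
  exact forall_congr' fun σ => continuous_coinduced_dom

/-- A map out of the product of a realization and the unit interval is continuous if its
restriction to each prism is. -/
theorem continuous_realization_prod {Y : Type*} [TopologicalSpace Y] {f : Realization K × unitInterval → Y}
    (h : ∀ σ : K.faces,
      Continuous fun p : stdSimplex ℝ σ.1 × unitInterval => f (simplexMap K σ p.1, p.2)) :
    Continuous f := by
  have hc : ∀ x : Realization K, Continuous fun t : unitInterval => f (x, t) := by
    intro x
    let w : stdSimplex ℝ x.1.support := ⟨fun v => x.1 v, fun v => x.2.1 v, by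
      rw [Finset.sum_coe_sort x.1.support (fun v => x.1 v)]
      exact x.2.2.1⟩
    have hw : simplexMap K ⟨x.1.support, x.2.2.2⟩ w = x := by
      apply Subtype.ext
      ext v
      by_cases hv : x.1 v = 0 <;> simp [simplexMap, extendByZero, w, hv]
    have := (h ⟨x.1.support, x.2.2.2⟩).comp (Continuous.prodMk_right w)
    simpa [Function.comp_def, hw] using this
  -- Coherence is known for the realization, not for its product with the interval; currying reduces
  -- to the former, and uncurrying works because the interval is locally compact.
  let F : Realization K → C(unitInterval, Y) := fun x => ⟨fun t => f (x, t), hc x⟩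
  have hF : Continuous F :=
    continuous_realization_iff.2 fun σ => (ContinuousMap.curry ⟨_, h σ⟩).continuous
  exact ContinuousMap.continuous_uncurry_of_continuous ⟨F, hF⟩

theorem simplexMap_apply_continuous (σ : K.faces) (v : V) :
    Continuous fun w : stdSimplex ℝ σ.1 => (simplexMap K σ w).1 v := by
  by_cases h : v ∈ σ.1
  · have : Continuous fun w : stdSimplex ℝ σ.1 => w.1 ⟨v, h⟩ :=
      (continuous_apply (⟨v, h⟩ : σ.1)).comp continuous_subtype_val
    refine this.congr fun w => ?_
    simp [simplexMap, extendByZero, h]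
  · simpa [simplexMap, extendByZero, h] using continuous_const

theorem simplexMap_support_subset (σ : K.faces) (w : stdSimplex ℝ σ.1) :
    (simplexMap K σ w).1.support ⊆ σ.1 := by
  intro v hv
  by_contra h
  simp [simplexMap, extendByZero, h] at hv

/-- A map into a realization which is continuous in each coordinate and takes values in a finite
subcomplex is continuous. -/
theorem continuous_of_finite_support {X : Type*} [TopologicalSpace X] {f : X → Realization K}
    (F : Finset V) (hF : ∀ x, (f x).1.support ⊆ F) (hc : ∀ v, Continuous fun x => (f x).1 v) :
    Continuous f := by
  classical
  let J := {σ : K.faces // σ.1 ∈ F.powerset}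
  have : Finite J := Finite.of_injective (β := F.powerset) (fun σ => ⟨σ.1.1, σ.2⟩)
    fun σ τ h => Subtype.ext (Subtype.ext (congrArg (fun s : F.powerset => s.1) h))
  -- The preimages of the finitely many simplices with vertices in `F` form a closed cover; on each,
  -- `f` factors continuously through a standard simplex.
  let A : J → Set X := fun σ => {x | ∀ v ∉ σ.1.1, (f x).1 v = 0}
  have hA : ∀ σ, IsClosed (A σ) := by
    intro σ
    simp only [A, Set.ofPred_forall]
    exact isClosed_iInter fun v => isClosed_iInter fun _ => isClosed_eq (hc v) continuous_const
  have hcov : ⋃ σ, A σ = Set.univ := by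
    refine Set.eq_univ_of_forall fun x => Set.mem_iUnion.2 ?_
    exact ⟨⟨⟨(f x).1.support, (f x).2.2.2⟩, Finset.mem_powerset.2 (hF x)⟩,
      fun v hv => Finsupp.notMem_support_iff.1 hv⟩
  refine (locallyFinite_of_finite A).continuous hcov hA fun σ => ?_
  rw [continuousOn_iff_continuous_domRestrict]
  let w : A σ → stdSimplex ℝ σ.1.1 := fun x => ⟨fun v => (f x.1).1 v, fun v => (f x.1).2.1 v, by
    rw [Finset.sum_coe_sort σ.1.1 (fun v => (f x.1).1 v)]
    refine Eq.trans ?_ (f x.1).2.2.1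
    refine (Finset.sum_subset (fun v hv => ?_) fun v _ hv => Finsupp.notMem_support_iff.1 hv).symm
    by_contra h
    exact Finsupp.mem_support_iff.1 hv (x.2 v h)⟩
  have hw : Continuous w := 
    continuous_induced_rng.2 (continuous_pi fun v => (hc v).comp continuous_subtype_val)
  have he : (A σ).domRestrict f = simplexMap K σ.1 ∘ w := by
    funext x
    apply Subtype.ext
    ext v
    by_cases hv : v ∈ σ.1.1
    · simp [simplexMap, extendByZero, w, hv, Set.domRestrict]
    · simpa [Set.domRestrict, simplexMap, extendByZero, w, hv] using x.2 v hv
  rw [he]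
  exact (continuous_simplexMap σ.1).comp hw

/-- Nonnegative nonzero coordinates, supported on a simplex: these become barycentric coordinates
after normalization. -/
structure IsHomogeneous (K : PreAbstractSimplicialComplex V) (y : V →₀ ℝ) : Prop where
  nonneg : ∀ v, 0 ≤ y v
  ne_zero : y ≠ 0
  support_subset : ∃ τ ∈ K.faces, y.support ⊆ τ

theorem IsHomogeneous.sum_pos {y : V →₀ ℝ} (h : IsHomogeneous K y) :
    0 < y.sum fun _ a => a :=
  Finset.sum_pos (fun v hv => lt_of_le_of_ne (h.nonneg v) (Finsupp.mem_support_iff.1 hv).symm)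
    (Finsupp.support_nonempty_iff.2 h.ne_zero)

/-- The point of the realization with given homogeneous coordinates. -/
noncomputable def IsHomogeneous.point {y : V →₀ ℝ} (h : IsHomogeneous K y) : Realization K :=
  ⟨(y.sum fun _ a => a)⁻¹ • y,
    fun v => mul_nonneg (inv_nonneg.2 h.sum_pos.le) (h.nonneg v), by
      rw [Finsupp.sum_smul_index (fun _ => rfl), ← Finsupp.mul_sum]
      exact inv_mul_cancel₀ h.sum_pos.ne', by
      obtain ⟨τ, hτ, hs⟩ := h.support_subset
      rw [Finsupp.support_smul_eq (inv_ne_zero h.sum_pos.ne')]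
      exact (K.isRelLowerSet_faces hτ).2 hs (Finsupp.support_nonempty_iff.2 h.ne_zero)⟩

theorem IsHomogeneous.point_congr {y z : V →₀ ℝ} (h : IsHomogeneous K y) (h' : IsHomogeneous K z)
    (e : y = z) : h.point = h'.point := by
  subst e
  rfl

theorem IsHomogeneous.point_eq {x : Realization K} (h : IsHomogeneous K x.1) : h.point = x := by
  apply Subtype.ext
  simp [point, x.2.2.1]

/-- A homotopy given by homogeneous coordinates. -/
theorem exists_homotopic (y : Realization K → unitInterval → V →₀ ℝ) (hy : ∀ x t, IsHomogeneous K (y x t))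
    (hF : ∀ σ : K.faces, ∃ F : Finset V, ∀ x t, x.1.support ⊆ σ.1 → (y x t).support ⊆ F)
    (hc : ∀ (σ : K.faces) (v : V),
      Continuous fun p : stdSimplex ℝ σ.1 × unitInterval => y (simplexMap K σ p.1) p.2 v) :
    ∃ g₀ g₁ : C(Realization K, Realization K), g₀.Homotopic g₁ ∧
      (∀ x, g₀ x = (hy x 0).point) ∧ ∀ x, g₁ x = (hy x 1).point := by
  have H : Continuous fun p : Realization K × unitInterval => (hy p.1 p.2).point := by
    refine continuous_realization_prod fun σ => ?_
    obtain ⟨F, hF⟩ := hF σ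
    have hF' : ∀ p : stdSimplex ℝ σ.1 × unitInterval, (y (simplexMap K σ p.1) p.2).support ⊆ F :=
      fun p => hF _ _ (simplexMap_support_subset σ p.1)
    refine continuous_of_finite_support F
      (fun p => Finsupp.support_smul.trans (hF' p)) fun v => ?_
    refine Continuous.mul (Continuous.inv₀ ?_ fun p => (hy _ _).sum_pos.ne') (hc σ v)
    have : (fun p : stdSimplex ℝ σ.1 × unitInterval => (y (simplexMap K σ p.1) p.2).sum fun _ a => a) =
        fun p => ∑ v ∈ F, y (simplexMap K σ p.1) p.2 v :=
      funext fun p => Finsupp.sum_of_support_subset _ (hF' p) _ fun _ _ => rfl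
    rw [this]
    exact continuous_finsetSum _ fun v _ => hc σ v
  have hs : ∀ t : unitInterval, Continuous fun x : Realization K => (hy x t).point := fun t =>
    H.comp (Continuous.prodMk_left t)
  refine ⟨⟨_, hs 0⟩, ⟨_, hs 1⟩, ⟨⟨⟨fun p => (hy p.2 p.1).point, H.comp continuous_swap⟩,
    fun _ => rfl, fun _ => rfl⟩⟩, fun _ => rfl, fun _ => rfl⟩

end Topology


/-! ### Barycentric subdivision by weights -/

section Weights

variable {V : Type*}

/-- A weight which is positive only if every coordinate in `S` exceeds the sum of the coordinates
outside of `S`. -/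
noncomputable def weight (S : Finset V) (z : V →₀ ℝ) : ℝ :=
  ∏ v ∈ S, max 0 (z v - ((z.sum fun _ a => a) - ∑ u ∈ S, z u))

theorem weight_nonneg (S : Finset V) (z : V →₀ ℝ) : 0 ≤ weight S z :=
  Finset.prod_nonneg fun _ _ => le_max_left _ _

theorem weight_support_pos {z : V →₀ ℝ} (hz : ∀ v, 0 ≤ z v) : 0 < weight z.support z := by
  refine Finset.prod_pos fun v hv => lt_max_of_lt_right ?_
  simpa [Finsupp.sum] using lt_of_le_of_ne (hz v) (Finsupp.mem_support_iff.1 hv).symm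

theorem lt_of_weight_ne_zero {S : Finset V} {z : V →₀ ℝ} (hz : ∀ v, 0 ≤ z v)
    (h : weight S z ≠ 0) {v w : V} (hv : v ∈ S) (hw : w ∉ S) : z w < z v := by
  classical
  have h1 : 0 < z v - ((z.sum fun _ a => a) - ∑ u ∈ S, z u) := by
    by_contra h2
    exact h (Finset.prod_eq_zero hv (max_eq_left (not_lt.1 h2)))
  have h2 : ∑ u ∈ insert w S, z u ≤ z.sum fun _ a => a := by
    rw [Finsupp.sum_of_support_subset z (Finset.subset_union_left (s₂ := insert w S)) _
      fun _ _ => rfl]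
    exact Finset.sum_le_sum_of_subset_of_nonneg Finset.subset_union_right fun u _ _ => hz u
  rw [Finset.sum_insert hw] at h2
  linarith

theorem subset_support_of_weight_ne_zero {S : Finset V} {z : V →₀ ℝ} (hz : ∀ v, 0 ≤ z v)
    (h : weight S z ≠ 0) : S ⊆ z.support := by
  classical
  intro v hv
  by_contra hv0
  have h1 : 0 < z v - ((z.sum fun _ a => a) - ∑ u ∈ S, z u) := by
    by_contra h2
    exact h (Finset.prod_eq_zero hv (max_eq_left (not_lt.1 h2)))
  have h2 : ∑ u ∈ S, z u ≤ z.sum fun _ a => a := by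
    rw [Finsupp.sum_of_support_subset z (Finset.subset_union_left (s₂ := S)) _ fun _ _ => rfl]
    exact Finset.sum_le_sum_of_subset_of_nonneg Finset.subset_union_right fun u _ _ => hz u
  rw [Finsupp.notMem_support_iff.1 hv0] at h1
  linarith

/-- If `v ∈ S \ T` and `w ∈ T \ S`, the two weights would force both `z w < z v` and `z v < z w`.
Thus the sets of nonzero weight form a chain, that is, a simplex of the barycentric subdivision. -/
theorem subset_or_subset_of_weight_ne_zero {S T : Finset V} {z : V →₀ ℝ} (hz : ∀ v, 0 ≤ z v)
    (hS : weight S z ≠ 0) (hT : weight T z ≠ 0) : S ⊆ T ∨ T ⊆ S := by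
  by_contra! h
  obtain ⟨v, hv, hv'⟩ := Finset.not_subset.1 h.1
  obtain ⟨w, hw, hw'⟩ := Finset.not_subset.1 h.2
  exact lt_asymm (lt_of_weight_ne_zero hz hS hv hw') (lt_of_weight_ne_zero hz hT hw hv')

theorem continuous_weight {X : Type*} [TopologicalSpace X] {f : X → V →₀ ℝ} (F : Finset V)
    (hF : ∀ x, (f x).support ⊆ F) (hc : ∀ v, Continuous fun x => f x v) (S : Finset V) :
    Continuous fun x => weight S (f x) := by
  have : (fun x => weight S (f x)) = fun x =>
      ∏ v ∈ S, max 0 (f x v - (∑ u ∈ F, f x u - ∑ u ∈ S, f x u)) :=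
    funext fun x => by
      simp only [weight, Finsupp.sum_of_support_subset _ (hF x) (fun _ a => a) fun _ _ => rfl]
  rw [this]
  fun_prop

open Classical in
/-- The image of the coordinates `z` in the barycentric subdivision under the map which sends the
barycenter of each simplex `S` to `k S`, up to normalization. -/
noncomputable def subdivisionMap (k : Finset V → V) (z : V →₀ ℝ) : V →₀ ℝ :=
  ∑ S ∈ z.support.powerset with S.Nonempty, Finsupp.single (k S) (weight S z)

-- Makes the index set independent of `z`, as needed for continuity: sets not contained in the
-- support have weight zero.
open Classical in
theorem subdivisionMap_eq (k : Finset V → V) {z : V →₀ ℝ} (hz : ∀ v, 0 ≤ z v) {F : Finset V}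
    (hF : z.support ⊆ F) :
    subdivisionMap k z = ∑ S ∈ F.powerset with S.Nonempty, Finsupp.single (k S) (weight S z) := by
  refine Finset.sum_subset (Finset.filter_subset_filter _ (Finset.powerset_mono.2 hF)) ?_
  intro S hS hS'
  rw [Finset.mem_filter] at hS hS'
  rw [Finsupp.single_eq_zero]
  by_contra h
  exact hS' ⟨Finset.mem_powerset.2 (subset_support_of_weight_ne_zero hz h), hS.2⟩

theorem subdivisionMap_nonneg (k : Finset V → V) (z : V →₀ ℝ) (v : V) :
    0 ≤ subdivisionMap k z v := by
  classical
  rw [subdivisionMap, Finsupp.finsetSum_apply]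
  refine Finset.sum_nonneg fun S _ => ?_
  rw [Finsupp.single_apply]
  split_ifs
  exacts [weight_nonneg S z, le_rfl]

theorem subdivisionMap_ne_zero (k : Finset V → V) {z : V →₀ ℝ} (hz : ∀ v, 0 ≤ z v) (h : z ≠ 0) :
    subdivisionMap k z ≠ 0 := by
  classical
  intro h0
  have h1 : 0 < subdivisionMap k z (k z.support) := by
    rw [subdivisionMap, Finsupp.finsetSum_apply]
    refine Finset.sum_pos' (fun S _ => ?_) ⟨z.support, ?_, ?_⟩
    · rw [Finsupp.single_apply]
      split_ifs
      exacts [weight_nonneg S z, le_rfl]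
    · simpa using h
    · simpa using weight_support_pos hz
  simp [h0] at h1

open Classical in
theorem subdivisionMap_support_subset (k : Finset V → V) (z : V →₀ ℝ) :
    (subdivisionMap k z).support ⊆
      {S ∈ z.support.powerset | S.Nonempty ∧ weight S z ≠ 0}.image k := by
  refine Finsupp.support_finsetSum.trans ?_
  intro v hv
  obtain ⟨S, hS, hv⟩ := Finset.mem_biUnion.1 hv
  rw [Finsupp.mem_support_single] at hv
  rw [Finset.mem_filter] at hS
  exact Finset.mem_image.2 ⟨S, Finset.mem_filter.2 ⟨hS.1, hS.2, hv.2⟩, hv.1.symm⟩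

theorem continuous_subdivisionMap (k : Finset V → V) {X : Type*} [TopologicalSpace X]
    {f : X → V →₀ ℝ} (hf : ∀ x v, 0 ≤ f x v) (F : Finset V) (hF : ∀ x, (f x).support ⊆ F)
    (hc : ∀ v, Continuous fun x => f x v) (v : V) :
    Continuous fun x => subdivisionMap k (f x) v := by
  classical
  simp only [fun x => subdivisionMap_eq k (hf x) (hF x), Finsupp.finsetSum_apply,
    Finsupp.single_apply]
  refine continuous_finsetSum _ fun S _ => ?_
  split_ifs
  exacts [continuous_weight F hF hc S, continuous_const]

theorem continuous_mapDomain (r : V → V) {X : Type*} [TopologicalSpace X] {f : X → V →₀ ℝ}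
    (F : Finset V) (hF : ∀ x, (f x).support ⊆ F) (hc : ∀ v, Continuous fun x => f x v) (v : V) :
    Continuous fun x => (f x).mapDomain r v := by
  classical
  have : ∀ x, (f x).mapDomain r v = ∑ u ∈ F, if r u = v then f x u else 0 := by
    intro x
    rw [Finsupp.mapDomain, Finsupp.sum_of_support_subset _ (hF x) _ (by simp),
      Finsupp.finsetSum_apply]
    simp [Finsupp.single_apply]
  simp only [this]
  refine continuous_finsetSum _ fun u _ => ?_
  split_ifs
  exacts [hc u, continuous_const]

theorem mapDomain_nonneg (r : V → V) {z : V →₀ ℝ} (hz : ∀ v, 0 ≤ z v) (v : V) :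
    0 ≤ z.mapDomain r v := by
  classical
  rw [Finsupp.mapDomain, Finsupp.sum, Finsupp.finsetSum_apply]
  refine Finset.sum_nonneg fun u _ => ?_
  rw [Finsupp.single_apply]
  split_ifs
  exacts [hz u, le_rfl]

theorem mapDomain_ne_zero (r : V → V) {z : V →₀ ℝ} (hz : ∀ v, 0 ≤ z v) (h : z ≠ 0) :
    z.mapDomain r ≠ 0 := by
  intro h0
  have h1 : ((z.mapDomain r).sum fun _ a => a) = z.sum fun _ a => a :=
    Finsupp.sum_mapDomain_index (fun _ => rfl) fun _ _ _ => rfl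
  rw [h0, Finsupp.sum_zero_index] at h1
  exact (Finset.sum_pos (fun v hv => lt_of_le_of_ne (hz v) (Finsupp.mem_support_iff.1 hv).symm)
    (Finsupp.support_nonempty_iff.2 h)).ne h1

end Weights


/-! ### Contraction of a complex with finite cones -/

section Contraction

variable {V : Type*}

open Classical in
/-- Recursive choice of a vertex for each finite set of vertices, where the choice for `S` depends
on the image of `S` under `r` and on the choices for the proper subsets of `S`. -/
noncomputable def chainVertex (c : Finset V → V) (r : V → V) (S : Finset V) : V :=
  Finset.strongInduction (p := fun _ => V)
    (fun S k => c (S.image r ∪ S.ssubsets.attach.image fun T =>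
      k T.1 (Finset.mem_ssubsets.1 T.2))) S

open Classical in
theorem chainVertex_eq (c : Finset V → V) (r : V → V) (S : Finset V) :
    chainVertex c r S = c (S.image r ∪ S.ssubsets.image (chainVertex c r)) := by
  rw [chainVertex, Finset.strongInduction_eq]
  congr 2
  ext v
  simp [chainVertex]

open Classical in
/-- The function `c` assigns to each finite set `F` of vertices in `P` the apex of a cone which
contains the full subcomplex on `F`. -/
def IsConeChoice (K : PreAbstractSimplicialComplex V) (P : V → Prop) (c : Finset V → V) : Prop :=
  ∀ F : Finset V, (∀ v ∈ F, P v) → ∀ σ ⊆ F, (σ = ∅ ∨ σ ∈ K.faces) → insert (c F) σ ∈ K.faces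

variable {K : PreAbstractSimplicialComplex V} {P : V → Prop} {c : Finset V → V} {r : V → V}

-- Induction along the chain: the vertex of its largest member `S` is an apex over the images under
-- `r` of the elements of `S` and the vertices of all proper subsets of `S`, hence over everything
-- obtained so far.
open Classical in
theorem chainVertex_simplex (hr : ∀ v, P (r v)) (hcP : ∀ F, P (c F))
    (hc : IsConeChoice K P c)
    {A : Finset V} (hA : A.image r = ∅ ∨ A.image r ∈ K.faces) (C : Finset (Finset V))
    (hAC : ∀ S ∈ C, A ⊆ S) (hC : ∀ S ∈ C, ∀ T ∈ C, S ⊆ T ∨ T ⊆ S) :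
    A.image r ∪ C.image (chainVertex c r) = ∅ ∨
      A.image r ∪ C.image (chainVertex c r) ∈ K.faces := by
  revert hAC hC
  refine Finset.induction_on_max_value Finset.card C ?_ ?_
  · simpa using hA
  · intro S C hS hmax ih hAC hC
    right
    have ih := ih (fun T hT => hAC T (Finset.mem_insert_of_mem hT))
      fun T hT U hU => hC T (Finset.mem_insert_of_mem hT) U (Finset.mem_insert_of_mem hU)
    have hlt : ∀ T ∈ C, T ⊂ S := by
      intro T hT
      have hne : T ≠ S := fun h => hS (h ▸ hT)
      rcases hC T (Finset.mem_insert_of_mem hT) S (Finset.mem_insert_self _ _) with h | h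
      · exact lt_of_le_of_ne h hne
      · exact absurd (Finset.eq_of_subset_of_card_le h (hmax T hT)).symm hne
    rw [Finset.image_insert, Finset.union_insert, chainVertex_eq c r S]
    refine hc _ ?_ _ ?_ ih
    · intro v hv
      rcases Finset.mem_union.1 hv with hv | hv
      · obtain ⟨u, -, rfl⟩ := Finset.mem_image.1 hv
        exact hr u
      · obtain ⟨T, -, rfl⟩ := Finset.mem_image.1 hv
        rw [chainVertex_eq]
        exact hcP _
    · exact Finset.union_subset_union
        (Finset.image_subset_image (hAC S (Finset.mem_insert_self _ _)))
        (Finset.image_subset_image fun T hT => Finset.mem_ssubsets.2 (hlt T hT))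

/-- The support of `z` need not be a simplex: the subdivision of the full simplex on `V` lands in
`K`. -/
theorem isHomogeneous_subdivisionMap (hr : ∀ v, P (r v)) (hcP : ∀ F, P (c F))
    (hc : IsConeChoice K P c) {z : V →₀ ℝ} (hz : ∀ v, 0 ≤ z v) (hz0 : z ≠ 0) :
    IsHomogeneous K (subdivisionMap (chainVertex c r) z) := by
  classical
  refine ⟨subdivisionMap_nonneg _ z, subdivisionMap_ne_zero _ hz hz0, ?_⟩
  have hs := subdivisionMap_support_subset (chainVertex c r) z
  refine ⟨_, ?_, hs⟩
  have := chainVertex_simplex (A := ∅) hr hcP hc (by simp)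
    {S ∈ z.support.powerset | S.Nonempty ∧ weight S z ≠ 0} (by simp) (fun S hS T hT =>
      subset_or_subset_of_weight_ne_zero hz (Finset.mem_filter.1 hS).2.2
        (Finset.mem_filter.1 hT).2.2)
  rw [Finset.image_empty, Finset.empty_union] at this
  refine this.resolve_left fun h => ?_
  rw [h, Finset.subset_empty, Finsupp.support_eq_empty] at hs
  exact subdivisionMap_ne_zero _ hz hz0 hs

/-- The part of the coordinates above the level `t`. -/
noncomputable def above (t : unitInterval) (z : V →₀ ℝ) : V →₀ ℝ :=
  z.mapRange (fun a => max 0 (a - t)) (by simpa using t.2.1)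

/-- The part of the coordinates below the level `t`. -/
noncomputable def below (t : unitInterval) (z : V →₀ ℝ) : V →₀ ℝ :=
  z.mapRange (fun a => min a t) (by simpa using t.2.1)

theorem below_nonneg {z : V →₀ ℝ} (hz : ∀ v, 0 ≤ z v) (t : unitInterval) (v : V) :
    0 ≤ below t z v := by
  simpa [below] using ⟨hz v, t.2.1⟩

theorem above_nonneg (z : V →₀ ℝ) (t : unitInterval) (v : V) : 0 ≤ above t z v := by
  simp [above]

theorem below_eq_self_of_above_eq_zero {z : V →₀ ℝ} {t : unitInterval} (h : above t z = 0) :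
    below t z = z := by
  ext v
  have := DFunLike.congr_fun h v
  simp only [above, Finsupp.mapRange_apply, Finsupp.coe_zero, Pi.zero_apply, max_eq_left_iff,
    sub_nonpos] at this
  simpa [below] using this

theorem isHomogeneous_above_add_below (hr : ∀ v, P (r v)) (hcP : ∀ F, P (c F))
    (hrK : ∀ σ ∈ K.faces, ∃ τ ∈ K.faces, ∀ v ∈ σ, v ∈ τ ∧ r v ∈ τ)
    (hc : IsConeChoice K P c) (x : Realization K) (t : unitInterval) :
    IsHomogeneous K ((above t x.1).mapDomain r +
      subdivisionMap (chainVertex c r) (below t x.1)) := by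
  classical
  have hx := x.2.1
  have hne : (above t x.1).mapDomain r +
      subdivisionMap (chainVertex c r) (below t x.1) ≠ 0 := by
    intro h
    have h1 : ∀ v, (above t x.1).mapDomain r v = 0 ∧
        subdivisionMap (chainVertex c r) (below t x.1) v = 0 := fun v =>
      (add_eq_zero_iff_of_nonneg (mapDomain_nonneg r (above_nonneg x.1 t) v)
        (subdivisionMap_nonneg _ _ v)).1 (DFunLike.congr_fun h v)
    have h2 : above t x.1 = 0 := by
      by_contra h2
      exact mapDomain_ne_zero r (above_nonneg x.1 t) h2 (Finsupp.ext fun v => (h1 v).1)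
    refine subdivisionMap_ne_zero (chainVertex c r) hx
      (Finsupp.support_nonempty_iff.1 x.support_nonempty) ?_
    rw [below_eq_self_of_above_eq_zero h2] at h1
    exact Finsupp.ext fun v => (h1 v).2
  refine ⟨fun v => add_nonneg (mapDomain_nonneg r (above_nonneg x.1 t) v)
    (subdivisionMap_nonneg _ _ v), hne, ?_⟩
  have hA : (above t x.1).support.image r = ∅ ∨ (above t x.1).support.image r ∈ K.faces := by
    rw [or_iff_not_imp_left, ← ne_eq, ← Finset.nonempty_iff_ne_empty]
    intro h
    obtain ⟨τ, hτ, h'⟩ := hrK _ x.2.2.2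
    refine (K.isRelLowerSet_faces hτ).2 (fun v hv => ?_) h
    obtain ⟨u, hu, rfl⟩ := Finset.mem_image.1 hv
    exact (h' u (Finsupp.support_mapRange hu)).2
  have := chainVertex_simplex hr hcP hc hA
    {S ∈ (below t x.1).support.powerset | S.Nonempty ∧ weight S (below t x.1) ≠ 0} ?_
    (fun S hS T hT => subset_or_subset_of_weight_ne_zero (below_nonneg hx t)
      (Finset.mem_filter.1 hS).2.2 (Finset.mem_filter.1 hT).2.2)
  · have hs := Finsupp.support_add.trans (Finset.union_subset_union
      (Finsupp.mapDomain_support (f := r) (s := above t x.1))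
      (subdivisionMap_support_subset (chainVertex c r) (below t x.1)))
    refine ⟨_, this.resolve_left fun h => ?_, hs⟩
    rw [h, Finset.subset_empty, Finsupp.support_eq_empty] at hs
    exact hne hs
  · intro S hS w hw
    obtain ⟨-, ⟨v, hv⟩, hS⟩ := Finset.mem_filter.1 hS
    -- A vertex `w` above level `t` has the maximal truncated coordinate `t`, so a set of nonzero
    -- weight cannot omit it.
    by_contra hwS
    have h1 := lt_of_weight_ne_zero (below_nonneg hx t) hS hv hwS
    have h2 : (t : ℝ) < x.1 w := by
      by_contra h2
      exact Finsupp.mem_support_iff.1 hw (by simpa [above] using h2)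
    simp only [below, Finsupp.mapRange_apply, min_eq_right h2.le] at h1
    exact absurd (min_le_right (x.1 v) (t : ℝ)) (not_le.2 h1)

theorem isHomogeneous_segment
    (hrK : ∀ σ ∈ K.faces, ∃ τ ∈ K.faces, ∀ v ∈ σ, v ∈ τ ∧ r v ∈ τ)
    (x : Realization K) (t : unitInterval) :
    IsHomogeneous K ((1 - t : ℝ) • x.1 + (t : ℝ) • x.1.mapDomain r) := by
  classical
  have hx := x.2.1
  have h1 : (0 : ℝ) ≤ 1 - t := sub_nonneg.2 t.2.2
  have hm := mapDomain_nonneg r hx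
  have hx0 := Finsupp.support_nonempty_iff.1 x.support_nonempty
  refine ⟨fun v => add_nonneg (mul_nonneg h1 (hx v)) (mul_nonneg t.2.1 (hm v)), fun h => ?_, ?_⟩
  · have h2 : ∀ v, (1 - t : ℝ) * x.1 v = 0 ∧ (t : ℝ) * x.1.mapDomain r v = 0 := fun v =>
      (add_eq_zero_iff_of_nonneg (mul_nonneg h1 (hx v)) (mul_nonneg t.2.1 (hm v))).1
        (DFunLike.congr_fun h v)
    by_cases ht : (t : ℝ) = 0
    · exact hx0 (Finsupp.ext fun v => by simpa [ht] using (h2 v).1)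
    · exact mapDomain_ne_zero r hx hx0 (Finsupp.ext fun v => by simpa [ht] using (h2 v).2)
  · obtain ⟨τ, hτ, h'⟩ := hrK _ x.2.2.2
    refine ⟨τ, hτ, Finsupp.support_add.trans (Finset.union_subset ?_ ?_)⟩
    · exact Finsupp.support_smul.trans fun v hv => (h' v hv).1
    · refine Finsupp.support_smul.trans (Finsupp.mapDomain_support.trans fun v hv => ?_)
      obtain ⟨u, hu, rfl⟩ := Finset.mem_image.1 hv
      exact (h' u hu).2

theorem simplexMap_prod_apply_continuous (σ : K.faces) (v : V) :
    Continuous fun p : stdSimplex ℝ σ.1 × unitInterval => (simplexMap K σ p.1).1 v :=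
  (simplexMap_apply_continuous σ v).comp continuous_fst

theorem exists_homotopic_segment
    (hrK : ∀ σ ∈ K.faces, ∃ τ ∈ K.faces, ∀ v ∈ σ, v ∈ τ ∧ r v ∈ τ) :
    ∃ g₀ g₁ : C(Realization K, Realization K), g₀.Homotopic g₁ ∧
      (∀ x, g₀ x = (isHomogeneous_segment hrK x 0).point) ∧
      ∀ x, g₁ x = (isHomogeneous_segment hrK x 1).point := by
  classical
  refine exists_homotopic _ (isHomogeneous_segment hrK) (fun σ => ⟨σ.1 ∪ σ.1.image r, ?_⟩) ?_
  · intro x t hx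
    exact Finsupp.support_add.trans (Finset.union_subset_union (Finsupp.support_smul.trans hx)
      (Finsupp.support_smul.trans
        (Finsupp.mapDomain_support.trans (Finset.image_subset_image hx))))
  · intro σ v
    have h1 := simplexMap_prod_apply_continuous σ v
    have h2 := continuous_mapDomain r σ.1 (fun p : stdSimplex ℝ σ.1 × unitInterval =>
      simplexMap_support_subset σ p.1) (simplexMap_prod_apply_continuous σ) v
    simp only [Finsupp.add_apply, Finsupp.smul_apply, smul_eq_mul]
    fun_prop

open Classical in
theorem subdivisionMap_support_subset_image (k : Finset V → V) {z : V →₀ ℝ} {F : Finset V}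
    (hz : z.support ⊆ F) : (subdivisionMap k z).support ⊆ F.powerset.image k :=
  (subdivisionMap_support_subset k z).trans (Finset.image_subset_image
    ((Finset.filter_subset _ _).trans (Finset.powerset_mono.2 hz)))

theorem exists_homotopic_above_add_below (hr : ∀ v, P (r v)) (hcP : ∀ F, P (c F))
    (hrK : ∀ σ ∈ K.faces, ∃ τ ∈ K.faces, ∀ v ∈ σ, v ∈ τ ∧ r v ∈ τ)
    (hc : IsConeChoice K P c) :
    ∃ g₀ g₁ : C(Realization K, Realization K), g₀.Homotopic g₁ ∧
      (∀ x, g₀ x = (isHomogeneous_above_add_below hr hcP hrK hc x 0).point) ∧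
      ∀ x, g₁ x = (isHomogeneous_above_add_below hr hcP hrK hc x 1).point := by
  classical
  refine exists_homotopic _ (isHomogeneous_above_add_below hr hcP hrK hc)
    (fun σ => ⟨σ.1.image r ∪ σ.1.powerset.image (chainVertex c r), ?_⟩) ?_
  · intro x t hx
    exact Finsupp.support_add.trans
      (Finset.union_subset_union (Finsupp.mapDomain_support.trans
        (Finset.image_subset_image (Finsupp.support_mapRange.trans hx)))
        (subdivisionMap_support_subset_image _ (Finsupp.support_mapRange.trans hx)))
  · intro σ v
    have h1 := continuous_mapDomain r
      (f := fun p : stdSimplex ℝ σ.1 × unitInterval => above p.2 (simplexMap K σ p.1).1) σ.1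
      (fun p => Finsupp.support_mapRange.trans (simplexMap_support_subset σ p.1))
      (fun v => by
        have := simplexMap_prod_apply_continuous σ v
        simp only [above, Finsupp.mapRange_apply]
        fun_prop) v
    have h2 := continuous_subdivisionMap (chainVertex c r)
      (f := fun p : stdSimplex ℝ σ.1 × unitInterval => below p.2 (simplexMap K σ p.1).1)
      (fun p => below_nonneg (simplexMap K σ p.1).2.1 p.2) σ.1
      (fun p => Finsupp.support_mapRange.trans (simplexMap_support_subset σ p.1))
      (fun v => by
        have := simplexMap_prod_apply_continuous σ v
        simp only [below, Finsupp.mapRange_apply]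
        fun_prop) v
    exact h1.add h2

theorem single_nonneg {a : ℝ} (ha : 0 ≤ a) (u v : V) : 0 ≤ Finsupp.single u a v := by
  classical
  rw [Finsupp.single_apply]
  split_ifs
  exacts [ha, le_rfl]

/-- The segment from a point to a vertex, in the full simplex on the vertex set. -/
noncomputable def toVertex (u : V) (x : V →₀ ℝ) (t : unitInterval) : V →₀ ℝ :=
  (1 - t : ℝ) • x + Finsupp.single u (t : ℝ)

theorem toVertex_nonneg (u : V) (x : Realization K) (t : unitInterval) (v : V) :
    0 ≤ toVertex u x.1 t v :=
  add_nonneg (mul_nonneg (sub_nonneg.2 t.2.2) (x.2.1 v)) (single_nonneg t.2.1 u v)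

theorem toVertex_ne_zero (u : V) (x : Realization K) (t : unitInterval) :
    toVertex u x.1 t ≠ 0 := fun h => by
  have h2 : ∀ v, (1 - t : ℝ) * x.1 v = 0 ∧ Finsupp.single u (t : ℝ) v = 0 := fun v =>
    (add_eq_zero_iff_of_nonneg (mul_nonneg (sub_nonneg.2 t.2.2) (x.2.1 v))
      (single_nonneg t.2.1 u v)).1 (DFunLike.congr_fun h v)
  have ht : (t : ℝ) = 0 := by simpa using (h2 u).2
  exact Finsupp.support_nonempty_iff.1 x.support_nonempty
    (Finsupp.ext fun v => by simpa [ht] using (h2 v).1)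

/-- The segment to `u` may leave the complex, but the subdivision map brings it back. -/
theorem exists_homotopic_toVertex (hr : ∀ v, P (r v)) (hcP : ∀ F, P (c F))
    (hc : IsConeChoice K P c) (u : V) :
    ∃ g₀ g₁ : C(Realization K, Realization K), g₀.Homotopic g₁ ∧
      (∀ x, g₀ x = (isHomogeneous_subdivisionMap hr hcP hc (toVertex_nonneg u x 0)
        (toVertex_ne_zero u x 0)).point) ∧
      ∀ x, g₁ x = (isHomogeneous_subdivisionMap hr hcP hc (toVertex_nonneg u x 1)
        (toVertex_ne_zero u x 1)).point := by
  classical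
  have hs : ∀ (x : Realization K) (t : unitInterval) (F : Finset V), x.1.support ⊆ F →
      (toVertex u x.1 t).support ⊆ F ∪ {u} := fun x t F hx =>
    Finsupp.support_add.trans (Finset.union_subset_union (Finsupp.support_smul.trans hx)
      Finsupp.support_single_subset)
  refine exists_homotopic (fun x t => subdivisionMap (chainVertex c r) (toVertex u x.1 t))
    (fun x t => isHomogeneous_subdivisionMap hr hcP hc (toVertex_nonneg u x t)
      (toVertex_ne_zero u x t))
    (fun σ => ⟨(σ.1 ∪ {u}).powerset.image (chainVertex c r), fun x t hx =>
      subdivisionMap_support_subset_image _ (hs x t _ hx)⟩) fun σ v => ?_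
  refine continuous_subdivisionMap (chainVertex c r)
    (f := fun p : stdSimplex ℝ σ.1 × unitInterval => toVertex u (simplexMap K σ p.1).1 p.2)
    (fun p => toVertex_nonneg u (simplexMap K σ p.1) p.2)
    (σ.1 ∪ {u}) (fun p => hs _ _ _ (simplexMap_support_subset σ p.1)) (fun v => ?_) v
  have := simplexMap_prod_apply_continuous σ v
  simp only [toVertex, Finsupp.add_apply, Finsupp.smul_apply, smul_eq_mul, Finsupp.single_apply]
  split_ifs <;> fun_prop

theorem subdivisionMap_zero (k : Finset V → V) : subdivisionMap k 0 = 0 := by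
  rw [subdivisionMap]
  exact Finset.sum_eq_zero fun S hS => by
    rw [Finset.mem_filter, Finsupp.support_zero, Finset.powerset_empty,
      Finset.mem_singleton] at hS
    exact absurd hS.1 hS.2.ne_empty

theorem below_zero (x : Realization K) : below 0 x.1 = 0 :=
  Finsupp.ext fun v => by simpa [below] using x.2.1 v

theorem above_zero (x : Realization K) : above 0 x.1 = x.1 :=
  Finsupp.ext fun v => by simpa [above] using x.2.1 v

theorem above_one (x : Realization K) : above 1 x.1 = 0 := Finsupp.ext fun v => by
  have : x.1 v ≤ 1 := by
    by_cases hv : v ∈ x.1.support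
    · exact (Finset.single_le_sum (fun v _ => x.2.1 v) hv).trans_eq x.2.2.1
    · rw [Finsupp.notMem_support_iff.1 hv]
      exact zero_le_one
  simpa [above] using this

/-- A simplicial complex is contractible if it has a self-map `r` contiguous to the identity and
with values in a set `P` of vertices, such that each finite set of vertices in `P` is contained in
a cone with apex in `P`. -/
theorem contractibleSpace_of_cones (hr : ∀ v, P (r v))
    (hrK : ∀ σ ∈ K.faces, ∃ τ ∈ K.faces, ∀ v ∈ σ, v ∈ τ ∧ r v ∈ τ) (hcP : ∀ F, P (c F))
    (hc : IsConeChoice K P c) : ContractibleSpace (Realization K) := by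
  obtain ⟨f₀, f₁, hf, hf0, hf1⟩ := exists_homotopic_segment hrK
  obtain ⟨g₀, g₁, hg, hg0, hg1⟩ := exists_homotopic_above_add_below hr hcP hrK hc
  obtain ⟨l₀, l₁, hl, hl0, hl1⟩ := exists_homotopic_toVertex hr hcP hc (c ∅)
  have e0 : f₀ = ContinuousMap.id _ := ContinuousMap.ext fun x => by
    have hx : IsHomogeneous K x.1 := ⟨x.2.1,
      Finsupp.support_nonempty_iff.1 x.support_nonempty, _, x.2.2.2, subset_rfl⟩
    rw [hf0]
    exact (IsHomogeneous.point_congr _ hx (by simp)).trans hx.point_eq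
  have e1 : f₁ = g₀ := ContinuousMap.ext fun x => by
    rw [hf1, hg0]
    refine IsHomogeneous.point_congr _ _ ?_
    rw [below_zero, above_zero]
    simp [subdivisionMap_zero]
  have e2 : g₁ = l₀ := ContinuousMap.ext fun x => by
    rw [hg1, hl0]
    refine IsHomogeneous.point_congr _ _ ?_
    rw [below_eq_self_of_above_eq_zero (above_one x), above_one]
    simp [toVertex]
  have hu := isHomogeneous_subdivisionMap (z := Finsupp.single (c ∅) 1) hr hcP hc
    (single_nonneg zero_le_one (c ∅)) (by simp)
  have e3 : l₁ = ContinuousMap.const _ hu.point := ContinuousMap.ext fun x => by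
    rw [hl1]
    exact IsHomogeneous.point_congr _ hu (by simp [toVertex])
  rw [contractible_iff_id_nullhomotopic]
  refine ⟨hu.point, ?_⟩
  rw [← e0, ← e3]
  exact (hf.trans (e1 ▸ hg)).trans (e2 ▸ hl)

end Contraction


/-! ### Extreme cosets and cone vertices -/

variable {G : Type*} [Group G]

/-- A non-extreme subgroup lies in a proper subgroup of finite index, which is extreme. -/
theorem exists_isExtreme_ge {H : Subgroup G} (hH : H ≠ ⊤) :
    ∃ L : Subgroup G, H ≤ L ∧ L ≠ ⊤ ∧ IsExtreme L := by
  by_cases h : IsExtreme H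
  · exact ⟨H, le_rfl, hH, h⟩
  · rw [IsExtreme, not_or, not_not] at h
    obtain ⟨-, L, hL, hf, hle⟩ := h
    exact ⟨L, hle, hL, Or.inl hf⟩

/-- A coset of a proper extreme subgroup. -/
def IsExtremeCoset (A : Set G) : Prop :=
  ∃ H : Subgroup G, (H ≠ ⊤ ∧ IsExtreme H) ∧ ∃ g : G, A = g • (H : Set G)

theorem exists_isExtremeCoset_superset (A : cosets (properSubgroups G)) :
    ∃ B : cosets (properSubgroups G), IsExtremeCoset (B : Set G) ∧ (A : Set G) ⊆ B := by
  obtain ⟨_, H, hH, g, rfl⟩ := A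
  obtain ⟨L, hle, hL, he⟩ := exists_isExtreme_ge hH
  exact ⟨⟨g • (L : Set G), L, hL, g, rfl⟩, ⟨L, ⟨hL, he⟩, g, rfl⟩, Set.smul_set_mono hle⟩

open Classical in
/-- A common complement gives a cone vertex. -/
theorem exists_cone_vertex
    (h : ∀ 𝓢 : Finset (Subgroup G), (∀ H ∈ 𝓢, H ≠ ⊤ ∧ IsExtreme H) →
      ∃ K : Subgroup G, IsCommonComplementOf K 𝓢)
    (F : Finset (cosets (properSubgroups G))) :
    ∃ B : cosets (properSubgroups G), IsExtremeCoset (B : Set G) ∧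
      ((∀ A ∈ F, IsExtremeCoset (A : Set G)) → ∀ σ ⊆ F,
        (σ = ∅ ∨ σ ∈ (cosetNerve (properSubgroups G)).faces) →
          insert B σ ∈ (cosetNerve (properSubgroups G)).faces) := by
  -- The apex must be extreme for every `F`, even one with non-extreme members, so these are
  -- discarded.
  let F' : Finset (cosets (properSubgroups G)) := F.filter fun A => IsExtremeCoset A.1
  have hF' : ∀ A : F', IsExtremeCoset (A.1 : Set G) := fun A => (Finset.mem_filter.1 A.2).2
  choose H hH g hg using hF'
  obtain ⟨K, hK, hHK⟩ := h (F'.attach.image H) (by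
    intro L hL
    obtain ⟨A, -, rfl⟩ := Finset.mem_image.1 hL
    exact hH A)
  obtain ⟨L, hKL, hL, hLe⟩ := exists_isExtreme_ge hK
  refine ⟨⟨L, L, hL, 1, (one_smul G _).symm⟩, ⟨L, ⟨hL, hLe⟩, 1, (one_smul G _).symm⟩, ?_⟩
  intro hF σ hσF hσ
  obtain ⟨x, hx⟩ : (⋂ A ∈ σ, (A : Set G)).Nonempty := by
    rcases hσ with rfl | hσ
    · exact ⟨1, by simp⟩
    · exact hσ.2
  obtain ⟨a, ha, b, hb, hab⟩ : x⁻¹ ∈ ((⨅ H' ∈ F'.attach.image H, H' : Subgroup G) : Set G) *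
      (K : Set G) := hHK ▸ Set.mem_univ _
  -- From `x⁻¹ = ab`, the point `xa = b⁻¹` lies in `L`; right multiplication by `a` preserves each
  -- coset in `σ`.
  refine ⟨Finset.insert_nonempty _ _, x * a, Set.mem_iInter₂.2 fun A hA => ?_⟩
  rcases Finset.mem_insert.1 hA with rfl | hA
  · have : x * a = b⁻¹ := by
      rw [eq_inv_iff_mul_eq_one, mul_assoc]
      simp only at hab
      rw [hab, mul_inv_cancel]
    rw [this]
    exact inv_mem (hKL hb)
  · have hA' : A ∈ F' := Finset.mem_filter.2 ⟨hσF hA, hF A (hσF hA)⟩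
    have haH : a ∈ H ⟨A, hA'⟩ := by
      have := Subgroup.mem_iInf.1 (Subgroup.mem_iInf.1 ha (H ⟨A, hA'⟩))
      exact this (Finset.mem_image_of_mem _ (Finset.mem_attach _ _))
    have hxA : x ∈ (A : Set G) := Set.mem_iInter₂.1 hx A hA
    rw [show (A : Set G) = _ from hg ⟨A, hA'⟩, mem_leftCoset_iff] at hxA ⊢
    rw [← mul_assoc]
    exact mul_mem hxA haH

end CosetNerve

theorem mainTheorem8 {G : Type*} [Group G]
    (h : ∀ 𝓢 : Finset (Subgroup G),
      (∀ H ∈ 𝓢, H ≠ ⊤ ∧ CosetNerve.IsExtreme H) →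
        ∃ K : Subgroup G, CosetNerve.IsCommonComplementOf K 𝓢) :
    ContractibleSpace
      (CosetNerve.Realization (CosetNerve.cosetNerve (CosetNerve.properSubgroups G))) := by
  classical
  choose r hr hrA using CosetNerve.exists_isExtremeCoset_superset (G := G)
  choose c hcP hc using CosetNerve.exists_cone_vertex h
  refine CosetNerve.contractibleSpace_of_cones
    (P := fun A : CosetNerve.cosets (CosetNerve.properSubgroups G) =>
      CosetNerve.IsExtremeCoset (A : Set G)) (c := c) (r := r) hr ?_ hcP ?_
  · intro σ hσ
    refine ⟨σ ∪ σ.image r, ⟨hσ.1.mono Finset.subset_union_left, ?_⟩, fun v hv =>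
      ⟨Finset.mem_union_left _ hv, Finset.mem_union_right _ (Finset.mem_image_of_mem r hv)⟩⟩
    obtain ⟨x, hx⟩ := hσ.2
    refine ⟨x, Set.mem_iInter₂.2 fun A hA => ?_⟩
    rcases Finset.mem_union.1 hA with hA | hA
    · exact Set.mem_iInter₂.1 hx A hA
    · obtain ⟨B, hB, rfl⟩ := Finset.mem_image.1 hA
      exact hrA B (Set.mem_iInter₂.1 hx B hB)
  · intro F hF σ hσ hσ'
    convert hc F hF σ hσ hσ'
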